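/- \textbf{Notation.} For $g\in\mathrm{Mat}(m,\mathbb{R})$ let $\|g\|$ be the operator norm induced by the Euclidean norm of $\mathbb{R}^m$, $g^\ast$ the transpose of $g$, and $s_1(g)\ge s_2(g)\ge\dots\ge s_m(g)\ge 0$ the singular values of $g$ (with $s_2(g):=0$ if $m=1$). The (first) gap ratio of $g\neq 0$ is $\mathrm{gr}(g):=s_1(g)/s_2(g)\in[1,+\infty]$, equal to $+\infty$ if $s_2(g)=0$; the zero matrix is regarded as having no gap, so a lower bound $\mathrm{gr}(g)>a$ with $a\geq 0$ includes that $g\ne 0$. If $\mathrm{gr}(g)>1$, then $s_1(g)=\|g\|$ is a simple singular value, and $\overline{\mathfrak v}(g)\in\mathbb{P}(\mathbb{R}^m)$ denotes the most expanding direction of $g$, i.e. the line $\ker(g^\ast g-s_1(g)^2 I)$; in this case also $\mathrm{gr}(g^\ast)>1$. On $\mathbb{P}(\mathbb{R}^m)$ use the distance $d(\hat u,\hat v):=\min\{\|u-v\|,\|u+v\|\}$ for unit vectors $u\in\hat u$, $v\in\hat v$. For matrices $g_0,g_1,\dots,g_{n-1}$ write $g^{(n)}:=g_{n-1}\cdots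 g_1g_0$. \textbf{Proposition.} There exist universal constants $c>0$ and $C>0$ such that the following holds for all $0<\epsilon<1$, all $0<\kappa\le c\,\epsilon^2$, all $m$, all $n\ge 1$ and all $g_0,g_1,\dots,g_{n-1}\in\mathrm{Mat}(m,\mathbb{R})$. If \begin{align*} \text{(gaps)}\quad & \mathrm{gr}(g_i)>\frac1\kappa && \text{for all } 0\le i\le n-1,\\ \text{(angles)}\quad & \frac{\|g_i\,g_{i-1}\|}{\|g_i\|\,\|g_{i-1}\|}>\epsilon && \text{for all } 1\le i\le n-1, \end{align*} then $\mathrm{gr}(g_0)>1$, $\mathrm{gr}(g_{n-1})>1$, $\mathrm{gr}(g^{(n)})>1$ (so that the directions below are defined), $$\max\left\{\, d\big(\overline{\mathfrak v}(g^{(n)\ast}),\overline{\mathfrak v}(g_{n-1}^\ast)\big),\ d\big(\overline{\mathfrak v}(g^{(n)}),\overline{\mathfrak v}(g_0)\big)\right\}\le C\,\frac{\kappa}{\epsilon},$$ and, if $n\ge 2$, $$\left|\,\log\|g^{(n)}\|+\sum_{i=1}^{n-2}\log\|g_i\|-\sum_{i=1}^{n-1}\log\|g_i\,g_{i-1}\|\,\right|\le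 C\,n\,\frac{\kappa}{\epsilon^2}.$$ -/

import Mathlib

open scoped Matrix Matrix.Norms.L2Operator

namespace AvalanchePrinciple

/-- The distance `d` on the projective space of a real inner product space:
`d(û, v̂) = min (‖u - v‖) (‖u + v‖)` for unit vectors `u ∈ û`, `v ∈ v̂`.
(Independence of the chosen unit vectors is `projDist_mk`.) -/
noncomputable def projDist {V : Type*} [NormedAddCommGroup V] [InnerProductSpace ℝ V]
    (p q : Projectivization ℝ V) : ℝ :=
  min ‖‖p.rep‖⁻¹ • p.rep - ‖q.rep‖⁻¹ • q.rep‖ ‖‖p.rep‖⁻¹ • p.rep + ‖q.rep‖⁻¹ • q.rep‖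

theorem normalized_rep_mk {V : Type*} [NormedAddCommGroup V] [InnerProductSpace ℝ V]
    {u : V} (hu : u ≠ 0) (hu1 : ‖u‖ = 1) :
    ‖(Projectivization.mk ℝ u hu).rep‖⁻¹ • (Projectivization.mk ℝ u hu).rep = u ∨
    ‖(Projectivization.mk ℝ u hu).rep‖⁻¹ • (Projectivization.mk ℝ u hu).rep = -u := by
  obtain ⟨a, ha⟩ := Projectivization.exists_smul_eq_mk_rep ℝ u hu
  rw [← ha, Units.smul_def, norm_smul, hu1, mul_one, smul_smul]
  have h0 : (a : ℝ) ≠ 0 := a.ne_zero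
  rcases lt_or_gt_of_ne h0 with h | h
  · right
    rw [Real.norm_of_nonpos h.le, inv_neg, neg_mul, inv_mul_cancel₀ h0, neg_smul, one_smul]
  · left
    rw [Real.norm_of_nonneg h.le, inv_mul_cancel₀ h0, one_smul]

theorem projDist_mk {V : Type*} [NormedAddCommGroup V] [InnerProductSpace ℝ V]
    {u v : V} (hu : u ≠ 0) (hv : v ≠ 0) (hu1 : ‖u‖ = 1) (hv1 : ‖v‖ = 1) :
    projDist (Projectivization.mk ℝ u hu) (Projectivization.mk ℝ v hv) =
      min ‖u - v‖ ‖u + v‖ := by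
  unfold projDist
  have e1 : ‖-u - v‖ = ‖u + v‖ := by rw [← norm_neg]; congr 1; abel
  have e2 : ‖-u + v‖ = ‖u - v‖ := by rw [← norm_neg]; congr 1; abel
  rcases normalized_rep_mk hu hu1 with h | h <;> rcases normalized_rep_mk hv hv1 with h' | h' <;>
    simp only [h, h', sub_neg_eq_add, e1, e2, ← sub_eq_add_neg]
  · exact min_comm _ _
  · exact min_comm _ _

/-- The `j`-th singular value of a real square matrix, counted from `j = 1` in decreasing order
(with the value `0` for `j` greater than the size of the matrix). -/
noncomputable def singularValue {m : ℕ} (g : Matrix (Fin m) (Fin m) ℝ) (j : ℕ) : ℝ :=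
  (Matrix.toEuclideanLin g).singularValues (j - 1)

/-- The first gap ratio `gr(g) = s₁(g) / s₂(g)`. It is `∞` if `s₂(g) = 0 < s₁(g)`; for `g = 0` the
value is `0`, so that the zero matrix never has a singular gap. -/
noncomputable def gapRatio {m : ℕ} (g : Matrix (Fin m) (Fin m) ℝ) : ENNReal :=
  ENNReal.ofReal (singularValue g 1) / ENNReal.ofReal (singularValue g 2)

/-- `g` has a first singular gap. -/
def HasFirstGap {m : ℕ} (g : Matrix (Fin m) (Fin m) ℝ) : Prop := 1 < gapRatio g

/-- The singular subspace of `g` associated with its largest singular value `s₁(g)`. -/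
noncomputable def topSingularSpace {m : ℕ} (g : Matrix (Fin m) (Fin m) ℝ) :
    Submodule ℝ (EuclideanSpace ℝ (Fin m)) :=
  Module.End.eigenspace (Matrix.toEuclideanLin (gᵀ * g)) (singularValue g 1 ^ 2)

theorem toEuclideanLin_transpose_mul {m : ℕ} (g : Matrix (Fin m) (Fin m) ℝ) :
    Matrix.toEuclideanLin (gᵀ * g) =
      LinearMap.adjoint (Matrix.toEuclideanLin g) ∘ₗ Matrix.toEuclideanLin g := by
  rw [← Matrix.toEuclideanLin_conjTranspose_eq_adjoint, Matrix.conjTranspose_eq_transpose_of_trivial]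
  exact Matrix.toLpLin_mul_same 2 gᵀ g

theorem HasFirstGap.lt {m : ℕ} {g : Matrix (Fin m) (Fin m) ℝ} (h : HasFirstGap g) :
    singularValue g 2 < singularValue g 1 := by
  by_contra hc
  push Not at hc
  have : gapRatio g ≤ 1 := by
    unfold gapRatio
    exact (ENNReal.div_le_div_right (ENNReal.ofReal_le_ofReal hc) _).trans ENNReal.div_self_le_one
  exact absurd h (not_lt.mpr this)

theorem HasFirstGap.finrank_topSingularSpace {m : ℕ} {g : Matrix (Fin m) (Fin m) ℝ}
    (h : HasFirstGap g) : Module.finrank ℝ (topSingularSpace g) = 1 := by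
  have hlt := h.lt
  unfold topSingularSpace
  rw [toEuclideanLin_transpose_mul]
  set T := Matrix.toEuclideanLin g with hT
  have hn : Module.finrank ℝ (EuclideanSpace ℝ (Fin m)) = m := by simp
  have h0 : singularValue g 1 = T.singularValues 0 := rfl
  have h1 : singularValue g 2 = T.singularValues 1 := rfl
  rw [h0, h1] at hlt
  have hm : 0 < m := by
    by_contra hm
    rw [T.singularValues_of_finrank_le (i := 0) (by omega)] at hlt
    exact absurd hlt (not_lt.mpr (T.singularValues_nonneg 1))
  rw [h0]
  have key := T.isSymmetric_adjoint_comp_self.card_filter_eigenvalues_eq hn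
    (T.singularValues 0 ^ 2)
  rw [← key, Finset.card_eq_one]
  refine ⟨⟨0, hm⟩, ?_⟩
  ext i
  simp only [Finset.mem_filter, Finset.mem_univ, true_and, Finset.mem_singleton]
  have hi : T.isSymmetric_adjoint_comp_self.eigenvalues hn i = T.singularValues i ^ 2 :=
    (T.sq_singularValues_fin hn i).symm
  rw [hi]
  constructor
  · intro hh
    by_contra hne
    have hpos : 1 ≤ (i : ℕ) := by
      rcases Nat.eq_zero_or_pos (i : ℕ) with h' | h'
      · exact absurd (Fin.ext h') hne
      · exact h'
    have hle := T.singularValues_antitone hpos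
    have hnn := T.singularValues_nonneg i
    have hh' : T.singularValues i ^ 2 = T.singularValues 0 ^ 2 := by exact_mod_cast hh
    nlinarith
  · rintro rfl
    simp

/-- The most expanding direction of `g`: the singular direction of the (simple) largest singular
value of `g`, a point of projective space. It is defined for matrices with a first singular gap. -/
noncomputable def mostExpandingDirection {m : ℕ} (g : Matrix (Fin m) (Fin m) ℝ)
    (h : HasFirstGap g) : Projectivization ℝ (EuclideanSpace ℝ (Fin m)) :=
  Projectivization.mk'' (topSingularSpace g) h.finrank_topSingularSpace

theorem singularValue_transpose {m : ℕ} (g : Matrix (Fin m) (Fin m) ℝ) (j : ℕ) :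
    singularValue gᵀ j = singularValue g j := by
  unfold singularValue
  set i := j - 1
  have hn : Module.finrank ℝ (EuclideanSpace ℝ (Fin m)) = m := by simp
  by_cases hi : i < m
  · rw [LinearMap.singularValues_of_lt _ hn hi, LinearMap.singularValues_of_lt _ hn hi]
    congr 1
    refine congrFun ?_ _
    rw [LinearMap.IsSymmetric.eigenvalues_eq_eigenvalues_iff,
      ← toEuclideanLin_transpose_mul, ← toEuclideanLin_transpose_mul, Matrix.transpose_transpose]
    simp only [Matrix.toLpLin_eq_toLin, Matrix.charpoly_toLin]
    rw [Matrix.charpoly_mul_comm]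
  · rw [LinearMap.singularValues_of_finrank_le _ (by omega),
      LinearMap.singularValues_of_finrank_le _ (by omega)]

theorem HasFirstGap.transpose {m : ℕ} {g : Matrix (Fin m) (Fin m) ℝ} (h : HasFirstGap g) :
    HasFirstGap gᵀ := by
  unfold HasFirstGap gapRatio at *
  rwa [singularValue_transpose, singularValue_transpose]

/-- The product `g⁽ⁿ⁾ = gₙ₋₁ ⋯ g₁ g₀`. -/
def chainProd {m : ℕ} (g : ℕ → Matrix (Fin m) (Fin m) ℝ) : ℕ → Matrix (Fin m) (Fin m) ℝ
  | 0 => 1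
  | n + 1 => g n * chainProd g n

end AvalanchePrinciple

/-! A matrix `g` with a large gap is, up to a relative error `κ`, the rank one map `u ↦ ‖g‖ ⟪v, u⟫
w`, where `w` spans the most expanding direction of `gᵀ`. If moreover the range of `P` is nearly the
line of `w'`, then `‖g * P‖ / (‖g‖ * ‖P‖)` is nearly `|⟪v, w'⟫|`. This number depends on `P` only
through `w'`, so the partial product may be replaced by its last factor, and the angle hypothesis on
consecutive pairs controls the whole chain.

The invariant is that each partial product lies within `2κ/ε`, relative to its own norm, of the line
of its last factor. Multiplying by the next matrix gives an absolute error `κ‖A‖‖P‖`, and the angle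
bound `ε/2` turns it back into the relative error `2κ/ε`, so errors do not accumulate
(`NearRankOne.avalanche_step`). The logarithms telescope in `avalanche_chain`. Closeness to a line
bounds the second singular value, which gives the gap of the product, and locates the top left
singular direction. The other direction follows by transposing the chain. -/

namespace AvalanchePrinciple

/-! ### Singular values and rank one approximation -/

section SingularValues

open scoped RealInnerProductSpace

variable {E : Type*} [NormedAddCommGroup E] [InnerProductSpace ℝ E] [FiniteDimensional ℝ E]

theorem norm_sq_apply_eq_sum (T : E →ₗ[ℝ] E) {n : ℕ} (hn : Module.finrank ℝ E = n) (x : E) :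
    ‖T x‖ ^ 2 = ∑ i : Fin n, T.singularValues i ^ 2 *
      ⟪T.isSymmetric_adjoint_comp_self.eigenvectorBasis hn i, x⟫ ^ 2 := by
  have hT := T.isSymmetric_adjoint_comp_self
  have h1 : ‖T x‖ ^ 2 = ⟪(LinearMap.adjoint T ∘ₗ T) x, x⟫ := by
    rw [LinearMap.comp_apply, LinearMap.adjoint_inner_left, real_inner_self_eq_norm_sq]
  rw [h1, ← (hT.eigenvectorBasis hn).sum_inner_mul_inner]
  refine Finset.sum_congr rfl fun i _ => ?_
  rw [hT, hT.apply_eigenvectorBasis hn i, T.sq_singularValues_fin hn, inner_smul_right,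
    real_inner_comm]
  simp only [RCLike.ofReal_real_eq_id, id]
  ring

theorem norm_apply_le_singularValues_zero (T : E →ₗ[ℝ] E) (x : E) :
    ‖T x‖ ≤ T.singularValues 0 * ‖x‖ := by
  refine le_of_sq_le_sq ?_ (mul_nonneg (T.singularValues_nonneg 0) (norm_nonneg x))
  rw [norm_sq_apply_eq_sum T rfl, mul_pow,
    ← (T.isSymmetric_adjoint_comp_self.eigenvectorBasis rfl).sum_sq_inner_right x,
    Finset.mul_sum]
  refine Finset.sum_le_sum fun i _ => mul_le_mul_of_nonneg_right ?_ (sq_nonneg _)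
  exact pow_le_pow_left₀ (T.singularValues_nonneg _) (T.singularValues_antitone (Nat.zero_le _)) 2

theorem norm_apply_eigenvectorBasis (T : E →ₗ[ℝ] E) {n : ℕ} (hn : Module.finrank ℝ E = n)
    (i : Fin n) :
    ‖T (T.isSymmetric_adjoint_comp_self.eigenvectorBasis hn i)‖ = T.singularValues i := by
  rw [← sq_eq_sq₀ (norm_nonneg _) (T.singularValues_nonneg _), norm_sq_apply_eq_sum T hn,
    Finset.sum_eq_single i]
  · simp
  · intro j _ hj
    rw [OrthonormalBasis.inner_eq_zero _ hj]
    simp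
  · simp

/-- Simplicity of the top singular value makes `w` orthogonal to all later eigenvectors, hence
parallel to the zeroth one, so `x` has no component there. An arbitrary eigenvector `w` is allowed
because it will be a representative of a projective point. -/
theorem norm_apply_le_singularValues_one (T : E →ₗ[ℝ] E)
    (hlt : T.singularValues 1 < T.singularValues 0) {w : E} (hw0 : w ≠ 0)
    (hw : (LinearMap.adjoint T) (T w) = T.singularValues 0 ^ 2 • w) {x : E} (hx : ⟪w, x⟫ = 0) :
    ‖T x‖ ≤ T.singularValues 1 * ‖x‖ := by
  have hT := T.isSymmetric_adjoint_comp_self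
  have horth : ∀ i : Fin (Module.finrank ℝ E), 1 ≤ (i : ℕ) →
      ⟪hT.eigenvectorBasis rfl i, w⟫ = 0 := by
    intro i hi
    have h1 : ⟪hT.eigenvectorBasis rfl i, (LinearMap.adjoint T ∘ₗ T) w⟫ =
        T.singularValues 0 ^ 2 * ⟪hT.eigenvectorBasis rfl i, w⟫ := by
      rw [LinearMap.comp_apply, hw, inner_smul_right]
    rw [← hT, hT.apply_eigenvectorBasis rfl i, ← T.sq_singularValues_fin rfl,
      inner_smul_left] at h1
    simp only [RCLike.ofReal_real_eq_id, id, RCLike.conj_to_real] at h1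
    have h2 := T.singularValues_antitone hi
    have h3 := T.singularValues_nonneg i
    have h4 : (T.singularValues i) ^ 2 < (T.singularValues 0) ^ 2 :=
      pow_lt_pow_left₀ (h2.trans_lt hlt) h3 two_ne_zero
    by_contra hne
    exact h4.ne (mul_right_cancel₀ hne h1)
  have hzero : ∀ i : Fin (Module.finrank ℝ E), (i : ℕ) = 0 →
      ⟪hT.eigenvectorBasis rfl i, x⟫ = 0 := by
    intro i hi
    have hothers : ∀ j : Fin (Module.finrank ℝ E), j ≠ i →
        ⟪hT.eigenvectorBasis rfl j, w⟫ = 0 := fun j hj =>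
      horth j (Nat.one_le_iff_ne_zero.mpr fun h => hj (Fin.ext (h.trans hi.symm)))
    have h1 : ⟪w, x⟫ = ⟪w, hT.eigenvectorBasis rfl i⟫ * ⟪hT.eigenvectorBasis rfl i, x⟫ := by
      rw [← (hT.eigenvectorBasis rfl).sum_inner_mul_inner]
      refine Finset.sum_eq_single i (fun j _ hj => ?_) (by simp)
      rw [real_inner_comm, hothers j hj, zero_mul]
    have h2 : ‖w‖ ^ 2 = ⟪hT.eigenvectorBasis rfl i, w⟫ ^ 2 := by
      rw [← (hT.eigenvectorBasis rfl).sum_sq_inner_right w]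
      refine Finset.sum_eq_single i (fun j _ hj => ?_) (by simp)
      rw [hothers j hj, zero_pow two_ne_zero]
    have h3 : ⟪w, hT.eigenvectorBasis rfl i⟫ ≠ 0 := by
      intro h
      rw [real_inner_comm, h] at h2
      exact hw0 (by simpa using h2)
    rw [hx] at h1
    exact (mul_eq_zero.mp h1.symm).resolve_left h3
  refine le_of_sq_le_sq ?_ (mul_nonneg (T.singularValues_nonneg 1) (norm_nonneg x))
  rw [norm_sq_apply_eq_sum T rfl, mul_pow, ← (hT.eigenvectorBasis rfl).sum_sq_inner_right x,
    Finset.mul_sum]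
  refine Finset.sum_le_sum fun i _ => ?_
  rcases Nat.eq_zero_or_pos (i : ℕ) with hi | hi
  · rw [hzero i hi]
    simp
  · exact mul_le_mul_of_nonneg_right (pow_le_pow_left₀ (T.singularValues_nonneg _)
      (T.singularValues_antitone hi) 2) (sq_nonneg _)

/-- Min-max argument: the plane of the two leading eigenvectors of `T* T` contains a nonzero vector
killed by `φ`. There `T` expands by at least its second singular value and by at most `δ`. -/
theorem singularValues_one_le_of_rankOne_approx (T : E →ₗ[ℝ] E) (φ : E →ₗ[ℝ] ℝ) (w : E) {δ : ℝ}
    (hδ : 0 ≤ δ) (h : ∀ x, ‖T x - φ x • w‖ ≤ δ * ‖x‖) : T.singularValues 1 ≤ δ := by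
  rcases le_or_gt (Module.finrank ℝ E) 1 with hE | hE
  · rwa [T.singularValues_of_finrank_le hE]
  set b := T.isSymmetric_adjoint_comp_self.eigenvectorBasis rfl with hb
  set i0 : Fin (Module.finrank ℝ E) := ⟨0, by omega⟩
  set i1 : Fin (Module.finrank ℝ E) := ⟨1, hE⟩
  have h01 : i0 ≠ i1 := by simp [i0, i1, Fin.ext_iff]
  obtain ⟨p, q, hpq, hφ⟩ : ∃ p q : ℝ, (p ≠ 0 ∨ q ≠ 0) ∧ φ (p • b i0 + q • b i1) = 0 := by
    by_cases h1 : φ (b i1) = 0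
    · exact ⟨0, 1, Or.inr one_ne_zero, by simp [h1]⟩
    · refine ⟨φ (b i1), -φ (b i0), Or.inl h1, ?_⟩
      simp only [map_add, map_smul, smul_eq_mul]
      ring
  set x := p • b i0 + q • b i1 with hx
  have hx0 : ⟪b i0, x⟫ = p := by
    simp [hx, inner_add_right, inner_smul_right, b.inner_eq_zero h01]
  have hx1 : ⟪b i1, x⟫ = q := by
    simp [hx, inner_add_right, inner_smul_right, b.inner_eq_zero h01.symm]
  have hxj : ∀ j, j ≠ i0 → j ≠ i1 → ⟪b j, x⟫ = 0 := by
    intro j hj0 hj1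
    simp [hx, inner_add_right, inner_smul_right, b.inner_eq_zero hj0, b.inner_eq_zero hj1]
  have hxne : x ≠ 0 := by
    intro h0
    rw [h0, inner_zero_right] at hx0 hx1
    rcases hpq with h | h
    · exact h hx0.symm
    · exact h hx1.symm
  have hlow : T.singularValues 1 * ‖x‖ ≤ ‖T x‖ := by
    refine le_of_sq_le_sq ?_ (norm_nonneg _)
    rw [norm_sq_apply_eq_sum T rfl, mul_pow, ← b.sum_sq_inner_right x, Finset.mul_sum]
    refine Finset.sum_le_sum fun i _ => ?_
    by_cases hi : (i : ℕ) ≤ 1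
    · exact mul_le_mul_of_nonneg_right (pow_le_pow_left₀ (T.singularValues_nonneg _)
        (T.singularValues_antitone hi) 2) (sq_nonneg _)
    · rw [← hb, hxj i (fun h => hi (by simp [h, i0])) (fun h => hi (by simp [h, i1]))]
      simp
  have hup := h x
  rw [hφ, zero_smul, sub_zero] at hup
  exact le_of_mul_le_mul_right (hlow.trans hup) (norm_pos_iff.mpr hxne)

end SingularValues

/-! ### Operators close to rank one -/

section RankOne

open scoped RealInnerProductSpace

variable {E : Type*} [NormedAddCommGroup E] [InnerProductSpace ℝ E]

/-- `A` is `δ`-close to an operator whose range is contained in the line of `w`. -/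
def NearLine (A : E →L[ℝ] E) (w : E) (δ : ℝ) : Prop :=
  ∃ φ : E →ₗ[ℝ] ℝ, ∀ u, ‖A u - φ u • w‖ ≤ δ * ‖u‖

/-- `A` is `κ‖A‖`-close to the rank one operator `u ↦ ‖A‖ ⟪v, u⟫ w`, for unit vectors `v, w`. -/
structure NearRankOne (A : E →L[ℝ] E) (v w : E) (κ : ℝ) : Prop where
  norm_left : ‖v‖ = 1
  norm_right : ‖w‖ = 1
  norm_sub_le : ∀ u, ‖A u - (‖A‖ * ⟪v, u⟫) • w‖ ≤ κ * ‖A‖ * ‖u‖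

theorem NearRankOne.nearLine {A : E →L[ℝ] E} {v w : E} {κ : ℝ} (h : NearRankOne A v w κ) :
    NearLine A w (κ * ‖A‖) :=
  ⟨‖A‖ • innerₗ E v, fun u => by simpa using h.norm_sub_le u⟩

/-- The range of `A * P` lies in that of `A`, so nothing is asked of `P`. The error is relative to
`‖A‖ * ‖P‖`; only a lower bound on `‖A * P‖` makes it relative to the product. -/
theorem NearRankOne.nearLine_comp {A : E →L[ℝ] E} {v w : E} {κ : ℝ} (hκ : 0 ≤ κ)
    (h : NearRankOne A v w κ) (P : E →L[ℝ] E) : NearLine (A * P) w (κ * ‖A‖ * ‖P‖) := by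
  refine ⟨(‖A‖ • innerₗ E v) ∘ₗ (P : E →ₗ[ℝ] E), fun u => ?_⟩
  calc ‖(A * P) u - ((‖A‖ • innerₗ E v) ∘ₗ (P : E →ₗ[ℝ] E)) u • w‖
      = ‖A (P u) - (‖A‖ * ⟪v, P u⟫) • w‖ := by simp
    _ ≤ κ * ‖A‖ * ‖P u‖ := h.norm_sub_le _
    _ ≤ κ * ‖A‖ * (‖P‖ * ‖u‖) := by gcongr; exact P.le_opNorm u
    _ = κ * ‖A‖ * ‖P‖ * ‖u‖ := by ring

theorem NearLine.mono {A : E →L[ℝ] E} {w : E} {δ δ' : ℝ} (h : NearLine A w δ) (hδ : δ ≤ δ') :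
    NearLine A w δ' := by
  obtain ⟨φ, hφ⟩ := h
  exact ⟨φ, fun u => (hφ u).trans (by gcongr)⟩

/-- The norm of a product is governed by the angle between the contracting hyperplane of the left
factor and the line approximating the range of the right factor. -/
theorem NearRankOne.abs_norm_mul_sub_le {A P : E →L[ℝ] E} {v w w' : E} {κ η : ℝ} (hκ : 0 ≤ κ)
    (hη : 0 ≤ η) (hA : NearRankOne A v w κ) (hw' : ‖w'‖ = 1) (hP : NearLine P w' (η * ‖P‖)) :
    |‖A * P‖ - |⟪v, w'⟫| * (‖A‖ * ‖P‖)| ≤ (κ + 2 * η) * (‖A‖ * ‖P‖) := by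
  obtain ⟨φ, hφ⟩ := hP
  have ha1 : |⟪v, w'⟫| ≤ 1 := by
    simpa [hA.norm_left, hw'] using abs_real_inner_le_norm v w'
  have ha0 := abs_nonneg ⟪v, w'⟫
  set a := |⟪v, w'⟫| with ha
  have hs := norm_nonneg A
  have hS := norm_nonneg P
  have hPu : ∀ u, ‖P u‖ ≤ ‖P‖ * ‖u‖ := P.le_opNorm
  have hφu : ∀ u, |φ u| ≤ ‖P u‖ + η * ‖P‖ * ‖u‖ ∧ ‖P u‖ ≤ |φ u| + η * ‖P‖ * ‖u‖ := by
    intro u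
    have h1 : ‖φ u • w'‖ = |φ u| := by rw [norm_smul, hw', mul_one, Real.norm_eq_abs]
    have h2 := norm_sub_norm_le (P u) (φ u • w')
    have h3 := norm_sub_norm_le (φ u • w') (P u)
    rw [norm_sub_rev] at h3
    rw [h1] at h2 h3
    constructor <;> linarith [hφ u]
  have hin : ∀ u, abs (|⟪v, P u⟫| - |φ u| * a) ≤ η * ‖P‖ * ‖u‖ := by
    intro u
    have h1 : ⟪v, P u⟫ - φ u * ⟪v, w'⟫ = ⟪v, P u - φ u • w'⟫ := by
      rw [inner_sub_right, inner_smul_right]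
    calc abs (|⟪v, P u⟫| - |φ u| * a) ≤ |⟪v, P u⟫ - φ u * ⟪v, w'⟫| := by
          rw [ha, ← abs_mul]; exact abs_abs_sub_abs_le _ _
      _ ≤ ‖v‖ * ‖P u - φ u • w'‖ := by rw [h1]; exact abs_real_inner_le_norm _ _
      _ ≤ η * ‖P‖ * ‖u‖ := by rw [hA.norm_left, one_mul]; exact hφ u
  have hout : ∀ u, abs (‖A (P u)‖ - ‖A‖ * |⟪v, P u⟫|) ≤ κ * ‖A‖ * (‖P‖ * ‖u‖) := by
    intro u
    have h1 : ‖(‖A‖ * ⟪v, P u⟫) • w‖ = ‖A‖ * |⟪v, P u⟫| := by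
      rw [norm_smul, hA.norm_right, mul_one, Real.norm_eq_abs, abs_mul, abs_of_nonneg hs]
    rw [← h1]
    refine (abs_norm_sub_norm_le _ _).trans ((hA.norm_sub_le _).trans ?_)
    gcongr
    exact hPu u
  rw [abs_le]
  constructor
  -- The lower bound is obtained as an operator norm bound for a multiple of `P`, so no vector
  -- attaining `‖P‖` is needed.
  · have key : a * ‖A‖ * ‖P‖ ≤ ‖A * P‖ + (κ + 2 * η) * (‖A‖ * ‖P‖) := by
      have : ‖(a * ‖A‖) • P‖ ≤ ‖A * P‖ + (κ + 2 * η) * (‖A‖ * ‖P‖) := by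
        refine ContinuousLinearMap.opNorm_le_bound _ (by positivity) fun u => ?_
        have h0 : ‖((a * ‖A‖) • P) u‖ = a * ‖A‖ * ‖P u‖ := by
          rw [smul_apply, norm_smul, Real.norm_of_nonneg (by positivity)]
        have h1 : ‖A (P u)‖ ≤ ‖A * P‖ * ‖u‖ := (A * P).le_opNorm u
        have h2 := (abs_le.mp (hin u)).1
        have h3 := (abs_le.mp (hout u)).1
        have hc : 0 ≤ η * ‖P‖ * ‖u‖ := by positivity
        have h4 : a * ‖P u‖ ≤ |φ u| * a + η * ‖P‖ * ‖u‖ := by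
          nlinarith [mul_le_mul_of_nonneg_left (hφu u).2 ha0, mul_le_mul_of_nonneg_right ha1 hc]
        have h5 : a * ‖P u‖ ≤ |⟪v, P u⟫| + 2 * (η * ‖P‖ * ‖u‖) := by linarith
        have h6 := mul_le_mul_of_nonneg_left h5 hs
        rw [h0]
        linarith
      rwa [norm_smul, Real.norm_of_nonneg (by positivity)] at this
    linarith
  · have : ‖A * P‖ ≤ (a + κ + 2 * η) * (‖A‖ * ‖P‖) := by
      refine ContinuousLinearMap.opNorm_le_bound _ (by positivity) fun u => ?_
      have h2 := (abs_le.mp (hin u)).2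
      have h3 := (abs_le.mp (hout u)).2
      have hc : 0 ≤ η * ‖P‖ * ‖u‖ := by positivity
      have h4 : |φ u| * a ≤ a * (‖P‖ * ‖u‖) + η * ‖P‖ * ‖u‖ := by
        nlinarith [mul_le_mul_of_nonneg_left (hφu u).1 ha0, mul_le_mul_of_nonneg_right ha1 hc,
          mul_le_mul_of_nonneg_left (hPu u) ha0]
      have h5 : |⟪v, P u⟫| ≤ a * (‖P‖ * ‖u‖) + 2 * (η * ‖P‖ * ‖u‖) := by linarith
      have h6 := mul_le_mul_of_nonneg_left h5 hs
      change ‖A (P u)‖ ≤ _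
      linarith
    linarith

/-- Comparison of `‖A * P‖` with `‖A * B‖` when the ranges of `P` and `B` are close to the same
line. -/
theorem NearRankOne.abs_norm_ratio_sub_le {A B P : E →L[ℝ] E} {v w v' w' : E} {κ η : ℝ}
    (hκ : 0 ≤ κ) (hη : 0 ≤ η) (hA : NearRankOne A v w κ) (hB : NearRankOne B v' w' κ)
    (hP : NearLine P w' (η * ‖P‖)) (hA0 : 0 < ‖A‖) (hB0 : 0 < ‖B‖) (hP0 : 0 < ‖P‖) :
    |‖A * P‖ / (‖A‖ * ‖P‖) - ‖A * B‖ / (‖A‖ * ‖B‖)| ≤ 4 * κ + 2 * η := by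
  have h1 := hA.abs_norm_mul_sub_le hκ hη hB.norm_right hP
  have h2 := hA.abs_norm_mul_sub_le hκ hκ hB.norm_right hB.nearLine
  have hAP : 0 < ‖A‖ * ‖P‖ := by positivity
  have hAB : 0 < ‖A‖ * ‖B‖ := by positivity
  have h1' : abs (‖A * P‖ / (‖A‖ * ‖P‖) - |⟪v, w'⟫|) ≤ κ + 2 * η := by
    rwa [← div_le_iff₀ hAP, ← abs_of_pos hAP, ← abs_div, abs_of_pos hAP, sub_div,
      mul_div_cancel_right₀ _ hAP.ne'] at h1
  have h2' : abs (‖A * B‖ / (‖A‖ * ‖B‖) - |⟪v, w'⟫|) ≤ κ + 2 * κ := by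
    rwa [← div_le_iff₀ hAB, ← abs_of_pos hAB, ← abs_div, abs_of_pos hAB, sub_div,
      mul_div_cancel_right₀ _ hAB.ne'] at h2
  rw [abs_le] at *
  constructor <;> linarith

/-- A unit vector in the range of `A`, reached with near optimal expansion, is close to `±w`. -/
theorem NearLine.min_norm_sub_le {A : E →L[ℝ] E} {w x y : E} {η : ℝ} (hη : 0 ≤ η)
    (hw : ‖w‖ = 1) (hA : NearLine A w (η * ‖A‖)) (hx : ‖x‖ = 1) (hy : ‖A‖ * ‖y‖ ≤ 1)
    (hxy : A y = x) : min ‖x - w‖ ‖x + w‖ ≤ 2 * η := by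
  obtain ⟨φ, hφ⟩ := hA
  have h1 : ‖x - φ y • w‖ ≤ η := by
    rw [← hxy]
    refine (hφ y).trans ?_
    rw [mul_assoc]
    exact mul_le_of_le_one_right hη hy
  have h2 : ‖φ y • w‖ = |φ y| := by rw [norm_smul, hw, mul_one, Real.norm_eq_abs]
  -- As `x` and `w` are unit vectors, `φ y` is within `η` of `1` or `-1`; its sign decides which
  -- term of the minimum is small.
  have h3 : abs (1 - |φ y|) ≤ η := by
    rw [← hx, ← h2]
    exact (abs_norm_sub_norm_le _ _).trans h1
  rcases le_total 0 (φ y) with h | h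
  · refine (min_le_left _ _).trans ?_
    rw [abs_of_nonneg h] at h3
    have : x - w = (x - φ y • w) - (1 - φ y) • w := by module
    rw [this]
    refine (norm_sub_le _ _).trans ?_
    rw [norm_smul, hw, mul_one, Real.norm_eq_abs]
    linarith
  · refine (min_le_right _ _).trans ?_
    rw [abs_of_nonpos h] at h3
    have : x + w = (x - φ y • w) + (1 - -φ y) • w := by module
    rw [this]
    refine (norm_add_le _ _).trans ?_
    rw [norm_smul, hw, mul_one, Real.norm_eq_abs]
    linarith

end RankOne

end AvalanchePrinciple

/-! ### Induction along a chain of operators -/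

namespace AvalanchePrinciple

theorem abs_log_sub_log_le {x y a : ℝ} (ha : 0 < a) (hx : a ≤ x) (hy : a ≤ y) :
    |Real.log x - Real.log y| ≤ |x - y| / a := by
  have key : ∀ {x y : ℝ}, a ≤ x → a ≤ y → Real.log x - Real.log y ≤ |x - y| / a := by
    intro x y hx hy
    have hx0 := ha.trans_le hx
    have hy0 := ha.trans_le hy
    rw [← Real.log_div hx0.ne' hy0.ne']
    calc Real.log (x / y) ≤ x / y - 1 := Real.log_le_sub_one_of_pos (by positivity)
      _ = (x - y) / y := by field_simp
      _ ≤ |x - y| / y := by gcongr; exact le_abs_self _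
      _ ≤ |x - y| / a := by gcongr
  rw [abs_sub_le_iff]
  exact ⟨key hx hy, by rw [abs_sub_comm]; exact key hy hx⟩

section Chain

variable {E : Type*} [NormedAddCommGroup E] [InnerProductSpace ℝ E]

/-- The constant `2κ/ε` reproduces itself: `P` enters the new error only through `‖A * P‖ ≥ (ε/2)
‖A‖ ‖P‖`, for which the old error merely has to be small compared with `ε`. -/
theorem NearRankOne.avalanche_step {A B P : E →L[ℝ] E} {v w v' w' : E} {κ ε : ℝ}
    (hε : 0 < ε) (hε1 : ε < 1) (hκ : 0 < κ) (hκε : κ ≤ 1 / 16 * ε ^ 2)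
    (hA : NearRankOne A v w κ) (hB : NearRankOne B v' w' κ)
    (hang : ε < ‖A * B‖ / (‖A‖ * ‖B‖)) (hP0 : 0 < ‖P‖)
    (hP : NearLine P w' (2 * (κ / ε) * ‖P‖)) :
    0 < ‖A * P‖ ∧ NearLine (A * P) w (2 * (κ / ε) * ‖A * P‖) ∧
      |Real.log ‖A * P‖ - Real.log ‖P‖ - Real.log ‖A * B‖ + Real.log ‖B‖| ≤
        16 * (κ / ε ^ 2) := by
  -- A zero denominator would make the quotient `0`, so the angle hypothesis already excludes zero
  -- operators.
  have hden : ‖A‖ * ‖B‖ ≠ 0 := by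
    intro h
    rw [h, div_zero] at hang
    exact hang.not_gt hε
  have hA0 : 0 < ‖A‖ := (norm_nonneg A).lt_of_ne' (left_ne_zero_of_mul hden)
  have hB0 : 0 < ‖B‖ := (norm_nonneg B).lt_of_ne' (right_ne_zero_of_mul hden)
  have hκle : κ ≤ κ / ε := by rw [le_div_iff₀ hε]; nlinarith
  have hsmall : 8 * (κ / ε) ≤ ε / 2 := by
    have : κ / ε ≤ 1 / 16 * ε := by rw [div_le_iff₀ hε]; linarith
    linarith
  -- With `η = 2κ/ε` the error `4κ + 2η` is at most `8κ/ε`; the constant `1/16` makes this at most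
  -- `ε/2`, half of the angle.
  have hdiff : |‖A * P‖ / (‖A‖ * ‖P‖) - ‖A * B‖ / (‖A‖ * ‖B‖)| ≤ 8 * (κ / ε) :=
    (hA.abs_norm_ratio_sub_le hκ.le (by positivity) hB hP hA0 hB0 hP0).trans (by linarith)
  have hlow : ε / 2 ≤ ‖A * P‖ / (‖A‖ * ‖P‖) := by
    have := (abs_le.mp hdiff).1
    linarith
  have hAP0 : 0 < ‖A * P‖ := by
    by_contra h
    rw [le_antisymm (not_lt.mp h) (norm_nonneg _), zero_div] at hlow
    linarith
  have hAB0 : 0 < ‖A * B‖ := by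
    by_contra h
    rw [le_antisymm (not_lt.mp h) (norm_nonneg _), zero_div] at hang
    linarith
  refine ⟨hAP0, (hA.nearLine_comp hκ.le P).mono ?_, ?_⟩
  · have h1 : ε / 2 * (‖A‖ * ‖P‖) ≤ ‖A * P‖ := (le_div_iff₀ (by positivity)).mp hlow
    calc κ * ‖A‖ * ‖P‖ = 2 * (κ / ε) * (ε / 2 * (‖A‖ * ‖P‖)) := by field_simp
      _ ≤ 2 * (κ / ε) * ‖A * P‖ := by gcongr
  -- Above `ε/2` the logarithm is `2/ε`-Lipschitz, whence `16κ/ε²`; the terms `log ‖A‖` cancel.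
  · have h1 := abs_log_sub_log_le (half_pos hε) hlow ((half_le_self hε.le).trans hang.le)
    rw [Real.log_div hAP0.ne' (by positivity), Real.log_div hAB0.ne' (by positivity),
      Real.log_mul hA0.ne' hP0.ne', Real.log_mul hA0.ne' hB0.ne'] at h1
    calc |Real.log ‖A * P‖ - Real.log ‖P‖ - Real.log ‖A * B‖ + Real.log ‖B‖|
        = |Real.log ‖A * P‖ - (Real.log ‖A‖ + Real.log ‖P‖) -
            (Real.log ‖A * B‖ - (Real.log ‖A‖ + Real.log ‖B‖))| := by congr 1; ring
      _ ≤ 8 * (κ / ε) / (ε / 2) := h1.trans (by gcongr)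
      _ = 16 * (κ / ε ^ 2) := by field_simp; norm_num

theorem avalanche_chain {A P : ℕ → E →L[ℝ] E} {v w : ℕ → E} {κ ε : ℝ} {n : ℕ}
    (hε : 0 < ε) (hε1 : ε < 1) (hκ : 0 < κ) (hκε : κ ≤ 1 / 16 * ε ^ 2)
    (hP1 : P 1 = A 0) (hPs : ∀ k, P (k + 1) = A k * P k) (hA0 : 0 < ‖A 0‖)
    (hA : ∀ i, i < n → NearRankOne (A i) (v i) (w i) κ)
    (hang : ∀ i, i + 1 < n → ε < ‖A (i + 1) * A i‖ / (‖A (i + 1)‖ * ‖A i‖)) (k : ℕ)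
    (hk : k < n) :
    0 < ‖P (k + 1)‖ ∧ NearLine (P (k + 1)) (w k) (2 * (κ / ε) * ‖P (k + 1)‖) ∧
      |Real.log ‖P (k + 1)‖ + ∑ i ∈ Finset.range k, Real.log ‖A i‖
        - ∑ i ∈ Finset.range k, Real.log ‖A (i + 1) * A i‖ - Real.log ‖A 0‖| ≤
        k * (16 * (κ / ε ^ 2)) := by
  induction k with
  | zero =>
    rw [zero_add, hP1]
    refine ⟨hA0, (hA 0 hk).nearLine.mono ?_, by simp⟩
    gcongr
    have : κ ≤ κ / ε := by rw [le_div_iff₀ hε]; nlinarith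
    linarith
  | succ k ih =>
    obtain ⟨h1, h2, h3⟩ := ih (Nat.lt_of_succ_lt hk)
    obtain ⟨h4, h5, h6⟩ := (hA (k + 1) hk).avalanche_step hε hε1 hκ hκε
      (hA k (Nat.lt_of_succ_lt hk)) (hang k hk) h1 h2
    rw [← hPs (k + 1)] at h4 h5 h6
    refine ⟨h4, h5, ?_⟩
    rw [Finset.sum_range_succ, Finset.sum_range_succ]
    push_cast
    rw [abs_le] at *
    constructor <;> linarith

end Chain

/-! ### Gaps and singular directions of matrices -/

section Matrices

variable {m : ℕ}

open scoped RealInnerProductSpace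

theorem norm_eq_singularValue_one (g : Matrix (Fin m) (Fin m) ℝ) : ‖g‖ = singularValue g 1 := by
  have hn : Module.finrank ℝ (EuclideanSpace ℝ (Fin m)) = m := by simp
  rw [← Matrix.l2_opNorm_toEuclideanCLM]
  have h0 : 0 ≤ singularValue g 1 := (Matrix.toEuclideanLin g).singularValues_nonneg 0
  refine le_antisymm (ContinuousLinearMap.opNorm_le_bound _ h0 fun x =>
    norm_apply_le_singularValues_zero (Matrix.toEuclideanLin g) x) ?_
  rcases Nat.eq_zero_or_pos m with hm | hm
  · unfold singularValue
    rw [(Matrix.toEuclideanLin g).singularValues_of_finrank_le (by simp [hm])]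
    exact norm_nonneg _
  · set b := (Matrix.toEuclideanLin g).isSymmetric_adjoint_comp_self.eigenvectorBasis hn
    have h1 := norm_apply_eigenvectorBasis (Matrix.toEuclideanLin g) hn ⟨0, hm⟩
    have h2 := (Matrix.toEuclideanCLM (𝕜 := ℝ) g).le_opNorm (b ⟨0, hm⟩)
    rw [b.norm_eq_one, mul_one] at h2
    exact h1.symm.le.trans h2

theorem HasFirstGap.singularValue_one_pos {g : Matrix (Fin m) (Fin m) ℝ} (h : HasFirstGap g) :
    0 < singularValue g 1 :=
  ((Matrix.toEuclideanLin g).singularValues_nonneg 1).trans_lt h.lt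

theorem hasFirstGap_of_lt {g : Matrix (Fin m) (Fin m) ℝ}
    (h : singularValue g 2 < singularValue g 1) : HasFirstGap g := by
  have h0 : 0 ≤ singularValue g 2 := (Matrix.toEuclideanLin g).singularValues_nonneg 1
  unfold HasFirstGap gapRatio
  rw [ENNReal.lt_div_iff_mul_lt (Or.inr ENNReal.one_ne_top) (Or.inl ENNReal.ofReal_ne_top), one_mul]
  exact (ENNReal.ofReal_lt_ofReal_iff (h0.trans_lt h)).mpr h

theorem singularValue_two_le_of_lt_gapRatio {g : Matrix (Fin m) (Fin m) ℝ} {κ : ℝ} (hκ : 0 < κ)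
    (h : ENNReal.ofReal (1 / κ) < gapRatio g) : singularValue g 2 ≤ κ * singularValue g 1 := by
  have h0 : 0 ≤ singularValue g 1 := (Matrix.toEuclideanLin g).singularValues_nonneg 0
  have h1 := ENNReal.mul_le_of_le_div h.le
  rw [← ENNReal.ofReal_mul (by positivity), ENNReal.ofReal_le_ofReal_iff h0] at h1
  rwa [one_div, inv_mul_le_iff₀ hκ] at h1

theorem hasFirstGap_of_lt_gapRatio {g : Matrix (Fin m) (Fin m) ℝ} {κ : ℝ} (hκ : 0 < κ)
    (hκ1 : κ ≤ 1) (h : ENNReal.ofReal (1 / κ) < gapRatio g) : HasFirstGap g := by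
  refine lt_of_le_of_lt ?_ h
  rw [ENNReal.one_le_ofReal]
  exact (one_le_div hκ).mpr hκ1

/-- A unit vector spanning a point of projective space. -/
noncomputable def unitRep {V : Type*} [NormedAddCommGroup V] [InnerProductSpace ℝ V]
    (p : Projectivization ℝ V) : V :=
  ‖p.rep‖⁻¹ • p.rep

theorem norm_unitRep {V : Type*} [NormedAddCommGroup V] [InnerProductSpace ℝ V]
    (p : Projectivization ℝ V) : ‖unitRep p‖ = 1 := by
  rw [unitRep, norm_smul, norm_inv, norm_norm, inv_mul_cancel₀ (norm_ne_zero_iff.mpr p.rep_nonzero)]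

theorem adjoint_apply_unitRep {g : Matrix (Fin m) (Fin m) ℝ} (h : HasFirstGap g) :
    LinearMap.adjoint (Matrix.toEuclideanLin g)
      (Matrix.toEuclideanLin g (unitRep (mostExpandingDirection g h))) =
      singularValue g 1 ^ 2 • unitRep (mostExpandingDirection g h) := by
  have hmem : unitRep (mostExpandingDirection g h) ∈ topSingularSpace g := by
    refine Submodule.smul_mem _ _ ?_
    have h1 : (mostExpandingDirection g h).submodule = topSingularSpace g :=
      Projectivization.submodule_mk'' _ _
    rw [← h1, Projectivization.submodule_eq]
    exact Submodule.mem_span_singleton_self _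
  rw [topSingularSpace, toEuclideanLin_transpose_mul, Module.End.mem_eigenspace_iff] at hmem
  exact hmem

theorem adjoint_toEuclideanLin_transpose (g : Matrix (Fin m) (Fin m) ℝ) :
    LinearMap.adjoint (Matrix.toEuclideanLin gᵀ) = Matrix.toEuclideanLin g := by
  rw [← Matrix.toEuclideanLin_conjTranspose_eq_adjoint,
    Matrix.conjTranspose_eq_transpose_of_trivial, Matrix.transpose_transpose]

theorem apply_transpose_unitRep {g : Matrix (Fin m) (Fin m) ℝ} (h : HasFirstGap g) :
    Matrix.toEuclideanLin g
      (Matrix.toEuclideanLin gᵀ (unitRep (mostExpandingDirection gᵀ h.transpose))) =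
      singularValue g 1 ^ 2 • unitRep (mostExpandingDirection gᵀ h.transpose) := by
  have := adjoint_apply_unitRep h.transpose
  rwa [adjoint_toEuclideanLin_transpose, singularValue_transpose] at this

theorem norm_transpose_apply_unitRep {g : Matrix (Fin m) (Fin m) ℝ} (h : HasFirstGap g) :
    ‖Matrix.toEuclideanLin gᵀ (unitRep (mostExpandingDirection gᵀ h.transpose))‖ =
      singularValue g 1 := by
  have h0 : 0 ≤ singularValue g 1 := (Matrix.toEuclideanLin g).singularValues_nonneg 0
  rw [← sq_eq_sq₀ (norm_nonneg _) h0, ← real_inner_self_eq_norm_sq, ← LinearMap.adjoint_inner_left,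
    adjoint_toEuclideanLin_transpose, apply_transpose_unitRep h, inner_smul_left,
    real_inner_self_eq_norm_sq, norm_unitRep]
  simp

/-- The part `z` of `g u` orthogonal to `w` satisfies `‖z‖² = ⟪gᵀ z, u⟫`, and `gᵀ` expands `z` by at
most the second singular value because `z ⊥ w`. Defining `v` from `w` through `gᵀ` fixes their
relative sign. -/
theorem nearRankOne_of_singularValue_two_le {g : Matrix (Fin m) (Fin m) ℝ} (h : HasFirstGap g)
    {κ : ℝ} (hκ : 0 ≤ κ) (hle : singularValue g 2 ≤ κ * singularValue g 1) :
    NearRankOne (Matrix.toEuclideanCLM (𝕜 := ℝ) g)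
      ((singularValue g 1)⁻¹ •
        Matrix.toEuclideanLin gᵀ (unitRep (mostExpandingDirection gᵀ h.transpose)))
      (unitRep (mostExpandingDirection gᵀ h.transpose)) κ := by
  have hpos := HasFirstGap.singularValue_one_pos h
  set w := unitRep (mostExpandingDirection gᵀ h.transpose) with hw
  have hw1 : ‖w‖ = 1 := norm_unitRep _
  refine ⟨?_, hw1, fun u => ?_⟩
  · rw [norm_smul, norm_transpose_apply_unitRep h, norm_inv, Real.norm_of_nonneg hpos.le,
      inv_mul_cancel₀ hpos.ne']
  · rw [Matrix.l2_opNorm_toEuclideanCLM, norm_eq_singularValue_one]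
    have h1 : singularValue g 1 * ⟪(singularValue g 1)⁻¹ • Matrix.toEuclideanLin gᵀ w, u⟫ =
        ⟪w, Matrix.toEuclideanLin g u⟫ := by
      rw [inner_smul_left, ← adjoint_toEuclideanLin_transpose g, LinearMap.adjoint_inner_right]
      simp only [RCLike.conj_to_real]
      rw [mul_inv_cancel_left₀ hpos.ne']
    rw [h1]
    change ‖Matrix.toEuclideanLin g u - ⟪w, Matrix.toEuclideanLin g u⟫ • w‖ ≤ _
    set y := Matrix.toEuclideanLin g u with hy
    set z := y - ⟪w, y⟫ • w with hz
    have hwz : ⟪w, z⟫ = 0 := by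
      rw [hz, inner_sub_right, inner_smul_right, real_inner_self_eq_norm_sq, hw1]
      ring
    have h2 : ‖Matrix.toEuclideanLin gᵀ z‖ ≤ singularValue gᵀ 2 * ‖z‖ :=
      norm_apply_le_singularValues_one (Matrix.toEuclideanLin gᵀ) h.transpose.lt
        (norm_ne_zero_iff.mp (by rw [hw1]; exact one_ne_zero))
        (adjoint_apply_unitRep h.transpose) hwz
    rw [singularValue_transpose] at h2
    have h3 : ‖z‖ * ‖z‖ ≤ κ * singularValue g 1 * ‖u‖ * ‖z‖ := by
      calc ‖z‖ * ‖z‖ = ⟪z, z⟫ := (real_inner_self_eq_norm_mul_norm z).symm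
        _ = ⟪z, y⟫ := by
          conv_lhs => rw [hz]
          rw [inner_sub_left, inner_smul_left, hwz, mul_zero, sub_zero, real_inner_comm]
        _ = ⟪Matrix.toEuclideanLin gᵀ z, u⟫ := by
          rw [hy, ← adjoint_toEuclideanLin_transpose, LinearMap.adjoint_inner_right]
        _ ≤ ‖Matrix.toEuclideanLin gᵀ z‖ * ‖u‖ := real_inner_le_norm _ _
        _ ≤ κ * singularValue g 1 * ‖z‖ * ‖u‖ := by
          gcongr
          exact h2.trans (by gcongr)
        _ = κ * singularValue g 1 * ‖u‖ * ‖z‖ := by ring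
    rcases (norm_nonneg z).eq_or_lt' with h0 | h0
    · rw [h0]
      positivity
    · exact le_of_mul_le_mul_right h3 h0

theorem hasFirstGap_of_nearLine {g : Matrix (Fin m) (Fin m) ℝ} {w : EuclideanSpace ℝ (Fin m)}
    {η : ℝ} (hη : 0 ≤ η) (hη1 : η < 1) (hg : 0 < ‖Matrix.toEuclideanCLM (𝕜 := ℝ) g‖)
    (h : NearLine (Matrix.toEuclideanCLM (𝕜 := ℝ) g) w
      (η * ‖Matrix.toEuclideanCLM (𝕜 := ℝ) g‖)) : HasFirstGap g := by
  obtain ⟨φ, hφ⟩ := h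
  rw [Matrix.l2_opNorm_toEuclideanCLM, norm_eq_singularValue_one] at hg hφ
  refine hasFirstGap_of_lt (lt_of_le_of_lt ?_ (mul_lt_of_lt_one_left hg hη1))
  exact singularValues_one_le_of_rankOne_approx (Matrix.toEuclideanLin g) φ w
    (by positivity) hφ

/-- A unit top singular vector `x` of `Gᵀ` equals `G y` for `y = s₁⁻² Gᵀ x`, and `‖G‖ ‖y‖ = 1`, so
`NearLine.min_norm_sub_le` applies. -/
theorem projDist_le_of_nearLine {G g : Matrix (Fin m) (Fin m) ℝ} (hG : HasFirstGap G)
    (hg : HasFirstGap g) {η : ℝ} (hη : 0 ≤ η)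
    (h : NearLine (Matrix.toEuclideanCLM (𝕜 := ℝ) G)
      (unitRep (mostExpandingDirection gᵀ hg.transpose))
      (η * ‖Matrix.toEuclideanCLM (𝕜 := ℝ) G‖)) :
    projDist (mostExpandingDirection Gᵀ hG.transpose) (mostExpandingDirection gᵀ hg.transpose) ≤
      2 * η := by
  have hpos := HasFirstGap.singularValue_one_pos hG
  refine h.min_norm_sub_le (x := unitRep (mostExpandingDirection Gᵀ hG.transpose))
    (y := (singularValue G 1 ^ 2)⁻¹ • Matrix.toEuclideanLin Gᵀ
      (unitRep (mostExpandingDirection Gᵀ hG.transpose))) hη (norm_unitRep _) (norm_unitRep _) ?_ ?_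
  · rw [Matrix.l2_opNorm_toEuclideanCLM, norm_eq_singularValue_one, norm_smul,
      norm_transpose_apply_unitRep hG, norm_inv, Real.norm_of_nonneg (by positivity)]
    refine le_of_eq ?_
    field_simp
  · rw [map_smul]
    change (singularValue G 1 ^ 2)⁻¹ • Matrix.toEuclideanLin G _ = _
    rw [apply_transpose_unitRep hG, smul_smul, inv_mul_cancel₀ (by positivity), one_smul]

/-! ### Matrix chains and their transposes -/

theorem chainProd_succ' (g : ℕ → Matrix (Fin m) (Fin m) ℝ) (n : ℕ) :
    chainProd g (n + 1) = chainProd (fun i => g (i + 1)) n * g 0 := by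
  induction n with
  | zero => simp [chainProd]
  | succ n ih =>
    rw [chainProd, ih, ← Matrix.mul_assoc]
    rfl

theorem chainProd_reverse_transpose {n : ℕ} {g h : ℕ → Matrix (Fin m) (Fin m) ℝ}
    (hgh : ∀ i, i < n → h i = (g (n - 1 - i))ᵀ) : chainProd h n = (chainProd g n)ᵀ := by
  induction n generalizing g with
  | zero => simp [chainProd]
  | succ n ih =>
    rw [chainProd_succ' g, Matrix.transpose_mul, chainProd, hgh n (Nat.lt_succ_self n),
      ih (g := fun i => g (i + 1))]
    · simp
    · intro i hi
      rw [hgh i (by omega)]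
      congr 2
      omega

theorem norm_transpose (g : Matrix (Fin m) (Fin m) ℝ) : ‖gᵀ‖ = ‖g‖ := by
  rw [← Matrix.conjTranspose_eq_transpose_of_trivial, Matrix.l2_opNorm_conjTranspose]

theorem gapRatio_transpose (g : Matrix (Fin m) (Fin m) ℝ) : gapRatio gᵀ = gapRatio g := by
  unfold gapRatio
  rw [singularValue_transpose, singularValue_transpose]

theorem mostExpandingDirection_congr {g h : Matrix (Fin m) (Fin m) ℝ} (hgh : g = h)
    (hg : HasFirstGap g) (hh : HasFirstGap h) :
    mostExpandingDirection g hg = mostExpandingDirection h hh := by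
  subst hgh
  rfl

theorem avalanche_left {ε κ : ℝ} (hε : 0 < ε) (hε1 : ε < 1) (hκ : 0 < κ)
    (hκε : κ ≤ 1 / 16 * ε ^ 2) {n : ℕ} {g : ℕ → Matrix (Fin m) (Fin m) ℝ}
    (hgap : ∀ i, i < n + 1 → ENNReal.ofReal (1 / κ) < gapRatio (g i))
    (hang : ∀ i, 1 ≤ i → i < n + 1 → ε < ‖g i * g (i - 1)‖ / (‖g i‖ * ‖g (i - 1)‖)) :
    ∃ (hprod : HasFirstGap (chainProd g (n + 1))) (hlast : HasFirstGap (g n)),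
      projDist (mostExpandingDirection (chainProd g (n + 1))ᵀ hprod.transpose)
        (mostExpandingDirection (g n)ᵀ hlast.transpose) ≤ 4 * (κ / ε) ∧
      |Real.log ‖chainProd g (n + 1)‖ + ∑ i ∈ Finset.range n, Real.log ‖g i‖
        - ∑ i ∈ Finset.range n, Real.log ‖g (i + 1) * g i‖ - Real.log ‖g 0‖| ≤
        n * (16 * (κ / ε ^ 2)) := by
  have hκ1 : κ ≤ 1 := by nlinarith
  have hfirst : ∀ i, i < n + 1 → HasFirstGap (g i) := fun i hi =>
    hasFirstGap_of_lt_gapRatio hκ hκ1 (hgap i hi)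
  have hrank : ∀ i, ∃ v w, ∀ hi : i < n + 1,
      w = unitRep (mostExpandingDirection (g i)ᵀ (hfirst i hi).transpose) ∧
      NearRankOne (Matrix.toEuclideanCLM (𝕜 := ℝ) (g i)) v w κ := by
    intro i
    by_cases hi : i < n + 1
    · exact ⟨_, _, fun _ => ⟨rfl, nearRankOne_of_singularValue_two_le (hfirst i hi) hκ.le
        (singularValue_two_le_of_lt_gapRatio hκ (hgap i hi))⟩⟩
    -- Junk vectors beyond the chain let `choose` produce sequences indexed by all of `ℕ`.
    · exact ⟨0, 0, fun h => absurd h hi⟩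
  choose v w hvw using hrank
  have hnorm : ∀ a : Matrix (Fin m) (Fin m) ℝ, ‖Matrix.toEuclideanCLM (𝕜 := ℝ) a‖ = ‖a‖ :=
    Matrix.l2_opNorm_toEuclideanCLM
  obtain ⟨h1, h2, h3⟩ := avalanche_chain (A := fun i => Matrix.toEuclideanCLM (𝕜 := ℝ) (g i))
    (P := fun k => Matrix.toEuclideanCLM (𝕜 := ℝ) (chainProd g k)) (n := n + 1) hε hε1 hκ hκε
    (by simp [chainProd]) (fun k => by simp only [chainProd, map_mul])
    (by
      rw [hnorm, norm_eq_singularValue_one]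
      exact HasFirstGap.singularValue_one_pos (hfirst 0 n.succ_pos))
    (fun i hi => (hvw i hi).2)
    (fun i hi => by
      simp only [← map_mul, hnorm]
      exact hang (i + 1) (by omega) hi) n n.lt_succ_self
  have hη : 2 * (κ / ε) < 1 := by
    have : κ / ε ≤ 1 / 16 * ε := by rw [div_le_iff₀ hε]; linarith
    linarith
  have hη0 : 0 ≤ 2 * (κ / ε) := by positivity
  have hprod := hasFirstGap_of_nearLine hη0 hη h1 h2
  refine ⟨hprod, hfirst n n.lt_succ_self, ?_, ?_⟩
  · rw [(hvw n n.lt_succ_self).1] at h2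
    exact (projDist_le_of_nearLine hprod (hfirst n n.lt_succ_self) hη0 h2).trans (by linarith)
  · simpa only [← map_mul, hnorm] using h3

/-- Transposing and reversing the chain exchanges its two ends; gap ratios and norms of consecutive
products are unchanged, so `avalanche_left` applies to the new chain. -/
theorem avalanche_right {ε κ : ℝ} (hε : 0 < ε) (hε1 : ε < 1) (hκ : 0 < κ)
    (hκε : κ ≤ 1 / 16 * ε ^ 2) {n : ℕ} {g : ℕ → Matrix (Fin m) (Fin m) ℝ}
    (hgap : ∀ i, i < n + 1 → ENNReal.ofReal (1 / κ) < gapRatio (g i))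
    (hang : ∀ i, 1 ≤ i → i < n + 1 → ε < ‖g i * g (i - 1)‖ / (‖g i‖ * ‖g (i - 1)‖))
    (hprod : HasFirstGap (chainProd g (n + 1))) (hfirst : HasFirstGap (g 0)) :
    projDist (mostExpandingDirection (chainProd g (n + 1)) hprod)
      (mostExpandingDirection (g 0) hfirst) ≤ 4 * (κ / ε) := by
  have hrev : chainProd (fun i => (g (n - i))ᵀ) (n + 1) = (chainProd g (n + 1))ᵀ :=
    chainProd_reverse_transpose fun i _ => rfl
  obtain ⟨h1, h2, h3, -⟩ := avalanche_left (n := n) (g := fun i => (g (n - i))ᵀ) hε hε1 hκ hκε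
    (fun i _ => by rw [gapRatio_transpose]; exact hgap _ (by omega))
    (fun i hi1 hi => by
      have h := hang (n - (i - 1)) (by omega) (by omega)
      have hidx : n - (i - 1) - 1 = n - i := by omega
      rw [hidx] at h
      rw [← Matrix.transpose_mul, norm_transpose, norm_transpose, norm_transpose]
      rwa [mul_comm ‖g (n - i)‖])
  rwa [mostExpandingDirection_congr (by rw [hrev, Matrix.transpose_transpose]) h1.transpose hprod,
    mostExpandingDirection_congr (by simp) h2.transpose hfirst] at h3

theorem sum_Icc_one_eq_sum_range (f : ℕ → ℝ) (n : ℕ) :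
    ∑ i ∈ Finset.Icc 1 n, f i = ∑ i ∈ Finset.range n, f (i + 1) := by
  induction n with
  | zero => simp
  | succ n ih => rw [Finset.sum_Icc_succ_top (by omega), ih, Finset.sum_range_succ]

end Matrices

end AvalanchePrinciple

theorem mainTheorem2 :
    ∃ c : ℝ, 0 < c ∧ ∃ C : ℝ, 0 < C ∧
      ∀ (ε κ : ℝ), 0 < ε → ε < 1 → 0 < κ → κ ≤ c * ε ^ 2 →
      ∀ (m n : ℕ), 1 ≤ n → ∀ g : ℕ → Matrix (Fin m) (Fin m) ℝ,
        (∀ i, i < n → ENNReal.ofReal (1 / κ) < AvalanchePrinciple.gapRatio (g i)) →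
        (∀ i, 1 ≤ i → i < n → ε < ‖g i * g (i - 1)‖ / (‖g i‖ * ‖g (i - 1)‖)) →
        (∃ (hprod : AvalanchePrinciple.HasFirstGap (AvalanchePrinciple.chainProd g n))
            (hfirst : AvalanchePrinciple.HasFirstGap (g 0))
            (hlast : AvalanchePrinciple.HasFirstGap (g (n - 1))),
          max
            (AvalanchePrinciple.projDist
              (AvalanchePrinciple.mostExpandingDirection
                (AvalanchePrinciple.chainProd g n)ᵀ hprod.transpose)
              (AvalanchePrinciple.mostExpandingDirection (g (n - 1))ᵀ hlast.transpose))
            (AvalanchePrinciple.projDist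
              (AvalanchePrinciple.mostExpandingDirection
                (AvalanchePrinciple.chainProd g n) hprod)
              (AvalanchePrinciple.mostExpandingDirection (g 0) hfirst))
          ≤ C * (κ / ε)) ∧
        (2 ≤ n →
          |Real.log ‖AvalanchePrinciple.chainProd g n‖
              + ∑ i ∈ Finset.Icc 1 (n - 2), Real.log ‖g i‖
              - ∑ i ∈ Finset.Icc 1 (n - 1), Real.log ‖g i * g (i - 1)‖|
            ≤ C * (n * (κ / ε ^ 2))) := by

  -- The directions need only the constant `4`; the logarithms need `16`.
  refine ⟨1 / 16, by norm_num, 16, by norm_num, ?_⟩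
  intro ε κ hε hε1 hκ hκε m n hn g hgap hang
  obtain ⟨n, rfl⟩ := Nat.exists_eq_succ_of_ne_zero (Nat.one_le_iff_ne_zero.mp hn)
  obtain ⟨hprod, hlast, hleft, hlog⟩ :=
    AvalanchePrinciple.avalanche_left hε hε1 hκ hκε hgap hang
  have hfirst : AvalanchePrinciple.HasFirstGap (g 0) :=
    AvalanchePrinciple.hasFirstGap_of_lt_gapRatio hκ (by nlinarith) (hgap 0 n.succ_pos)
  have hright := AvalanchePrinciple.avalanche_right hε hε1 hκ hκε hgap hang hprod hfirst
  have hκε0 : 0 ≤ κ / ε := by positivity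
  refine ⟨⟨hprod, hfirst, hlast, max_le (hleft.trans (by linarith)) (hright.trans (by linarith))⟩,
    fun hn2 => ?_⟩
  obtain ⟨k, rfl⟩ := Nat.exists_eq_succ_of_ne_zero (show n ≠ 0 by omega)
  have h1 : k.succ.succ - 2 = k := rfl
  have h2 : k.succ.succ - 1 = k + 1 := rfl
  rw [h1, h2, AvalanchePrinciple.sum_Icc_one_eq_sum_range,
    AvalanchePrinciple.sum_Icc_one_eq_sum_range]
  -- The split-off term `i = 0` cancels `log ‖g 0‖`, leaving the sum over interior factors.
  rw [Nat.succ_eq_add_one, Finset.sum_range_succ'] at hlog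
  simp only [Nat.add_sub_cancel, Nat.succ_eq_add_one] at hlog ⊢
  push_cast at hlog ⊢
  have hq : 0 ≤ κ / ε ^ 2 := by positivity
  rw [abs_le] at *
  constructor <;> linarith
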